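/- Let $M$ be a smooth finite-dimensional manifold (Hausdorff, $\sigma$-compact, without boundary) and let $\Pi$ be a Poisson bivector field on $M$, with bracket $\{f,g\}_\Pi=\Pi(df,dg)$. Let $A\to M$ be a Lie algebroid, i.e. a smooth real vector bundle of finite rank with an anchor $\rho:A\to TM$ and an $\mathbb R$-bilinear, skew-symmetric bracket on $\Gamma(A)$ that satisfies the Jacobi identity and $[a,fb]=f[a,b]+(\rho a\cdot f)\,b$. Let $D$ be a smooth linear connection on $A$; denote by $D$ also the dual connection on $A^*$, $\langle D_v\mu,a\rangle=v\cdot\langle\mu,a\rangle-\langle\mu,D_va\rangle$, and by $\check D$ the opposite $A$-connection on $TM$, $\check D_a v=[\rho a,v]+\rho(D_va)$, extended to forms and multivector fields as a derivation. Suppose that $D$ is Poisson anchored, i.e. $\check D\,\Pi=0$. Let $\widehat\Pi$ be the horizontal lift of $\Pi$ to the total space of $A^*$ by the dual connection, and let $\Pi_A$ be the Lie algebroid Poisson bivector field on $A^*$. That is, regarding sections $a,b$ of $A$ as fibrewise linear functions on $A^*$ and functions $f,g$ on $M$ as functions on $A^*$ by pullback, $$\{f,g\}_{\widehat\Pi}=\{f,g\}_\Pi,\qquad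 \{a,f\}_{\widehat\Pi}=\Pi(Da,df),\qquad \{a,b\}_{\widehat\Pi}=\Pi(Da,Db),$$ $$\{f,g\}_{\Pi_A}=0,\qquad \{a,f\}_{\Pi_A}=\rho a\cdot f,\qquad \{a,b\}_{\Pi_A}=[a,b].$$ Let $\mu$ be a smooth section of $A^*$. Then the following are equivalent. 1. $\mu$ is a bracket-compatible $D$-momentum section: for all $a,b\in\Gamma(A)$, $$\rho a=\iota_{\langle D\mu,a\rangle}\Pi\qquad\text{and}\qquad (d_A\mu)(a,b)=\Pi\bigl(\langle D\mu,a\rangle,\langle D\mu,b\rangle\bigr),$$ where $\iota_\alpha\Pi$ is the vector field with $\langle\beta,\iota_\alpha\Pi\rangle=\Pi(\alpha,\beta)$ and $(d_A\mu)(a,b)=\rho a\cdot\langle\mu,b\rangle-\rho b\cdot\langle\mu,a\rangle-\langle\mu,[a,b]\rangle$. 2. $\mu$, as a map $M\to A^*$, is a bivector map from $(M,\Pi)$ to $(A^*,\widehat\Pi+\Pi_A)$: for all $f,g\in C^\infty(A^*)$, $$\{f,g\}_{\widehat\Pi+\Pi_A}\circ\mu=\{f\circ\mu,\,g\circ\mu\}_\Pi.$$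 -/

import Mathlib

open Bundle Manifold
open scoped ContDiff Bundle Manifold Topology

noncomputable section

set_option linter.unusedSectionVars false

namespace HamLA

/-! ## Bivector fields, brackets of functions, Poisson structures, bivector maps -/

section Bivector

variable {E₁ : Type*} [NormedAddCommGroup E₁] [NormedSpace ℝ E₁]
  {H₁ : Type*} [TopologicalSpace H₁] (I₁ : ModelWithCorners ℝ E₁ H₁)
  (N : Type*) [TopologicalSpace N] [ChartedSpace H₁ N]
  {E₂ : Type*} [NormedAddCommGroup E₂] [NormedSpace ℝ E₂]
  {H₂ : Type*} [TopologicalSpace H₂] (I₂ : ModelWithCorners ℝ E₂ H₂)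
  (P : Type*) [TopologicalSpace P] [ChartedSpace H₂ P]

/-- A field of bivectors on the manifold `N`, a bivector at `x` being regarded as an alternating
bilinear form on the cotangent space at `x`. Smoothness is the separate predicate
`BivectorField.IsSmooth`. -/
structure BivectorField where
  toFun : ∀ x : N, (TangentSpace I₁ x →L[ℝ] ℝ) →ₗ[ℝ] (TangentSpace I₁ x →L[ℝ] ℝ) →ₗ[ℝ] ℝ
  self_eq_zero : ∀ (x : N) (α : TangentSpace I₁ x →L[ℝ] ℝ), toFun x α α = 0

/-- Smooth 1-forms. -/
abbrev OneForm [IsManifold I₁ ∞ N] : Type _ :=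
  ContMDiffSection I₁ (E₁ →L[ℝ] ℝ) ∞ (fun x : N => TangentSpace I₁ x →L[ℝ] ℝ)

variable {I₁ N I₂ P}

namespace BivectorField

instance : Add (BivectorField I₁ N) where
  add Φ Ψ :=
    { toFun := fun x => Φ.toFun x + Ψ.toFun x
      self_eq_zero := fun x α => by
        simp [LinearMap.add_apply, Φ.self_eq_zero, Ψ.self_eq_zero] }

/-- A bivector field is smooth if it maps pairs of smooth 1-forms to smooth functions. -/
def IsSmooth [IsManifold I₁ ∞ N] (Φ : BivectorField I₁ N) : Prop :=
  ∀ α β : OneForm I₁ N, ContMDiff I₁ 𝓘(ℝ, ℝ) ∞ (fun x => Φ.toFun x (α x) (β x))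

/-- The bracket `{f, g} = Φ(df, dg)`. -/
def bracket (Φ : BivectorField I₁ N) (f g : N → ℝ) : N → ℝ :=
  fun x => Φ.toFun x (mvfderiv I₁ f x) (mvfderiv I₁ g x)

/-- The map `Φ♯ : T*N → TN`, `α ↦ ι_α Φ`, characterised by `⟨β, ι_α Φ⟩ = Φ(α, β)`. -/
def IsContraction (Φ : BivectorField I₁ N) {x : N} (α : TangentSpace I₁ x →L[ℝ] ℝ)
    (v : TangentSpace I₁ x) : Prop :=
  ∀ β : TangentSpace I₁ x →L[ℝ] ℝ, β v = Φ.toFun x α β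

/-- A Poisson bivector field: smooth, and its bracket satisfies the Jacobi identity. -/
structure IsPoisson [IsManifold I₁ ∞ N] (Φ : BivectorField I₁ N) : Prop where
  smooth : Φ.IsSmooth
  jacobi : ∀ f g h : N → ℝ, ContMDiff I₁ 𝓘(ℝ, ℝ) ∞ f → ContMDiff I₁ 𝓘(ℝ, ℝ) ∞ g →
    ContMDiff I₁ 𝓘(ℝ, ℝ) ∞ h →
    Φ.bracket f (Φ.bracket g h) + Φ.bracket g (Φ.bracket h f) + Φ.bracket h (Φ.bracket f g) = 0

end BivectorField

/-- A bivector map `φ : (N, Φ) → (P, Ψ)`: a smooth map whose pullback takes the bracket of `Ψ` to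
the bracket of `Φ`. -/
structure IsBivectorMap (Φ : BivectorField I₁ N) (Ψ : BivectorField I₂ P) (φ : N → P) : Prop where
  smooth : ContMDiff I₁ I₂ ∞ φ
  pullback_bracket : ∀ f g : P → ℝ, ContMDiff I₂ 𝓘(ℝ, ℝ) ∞ f → ContMDiff I₂ 𝓘(ℝ, ℝ) ∞ g →
    Ψ.bracket f g ∘ φ = Φ.bracket (f ∘ φ) (g ∘ φ)

end Bivector

/-! ## Extension of a vector in a fibre to a smooth section -/

section Extension

variable {E : Type*} [NormedAddCommGroup E] [NormedSpace ℝ E] [FiniteDimensional ℝ E]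
  {M : Type*} [TopologicalSpace M] [ChartedSpace E M] [IsManifold 𝓘(ℝ, E) ∞ M]
  [T2Space M] [SigmaCompactSpace M]
  {F : Type*} [NormedAddCommGroup F] [NormedSpace ℝ F]
  {V : M → Type*} [TopologicalSpace (TotalSpace F V)]
  [∀ x, AddCommGroup (V x)] [∀ x, Module ℝ (V x)] [∀ x, TopologicalSpace (V x)]
  [FiberBundle F V] [VectorBundle ℝ F V]

variable (E F V) in
/-- Evaluation of smooth sections at a point. -/
def evalAt (x : M) : ContMDiffSection 𝓘(ℝ, E) F ∞ V →ₗ[ℝ] V x where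
  toFun s := s x
  map_add' _ _ := rfl
  map_smul' _ _ := rfl

theorem evalAt_surjective [ContMDiffVectorBundle ∞ F V 𝓘(ℝ, E)] (x : M) :
    Function.Surjective (evalAt E F V x) := by
  classical
  intro v
  obtain ⟨s, hs⟩ := exists_contMDiffSection_forall_mem_convex_of_local (n := ⊤) 𝓘(ℝ, E) V
    (fun y => if h : y = x then {h ▸ v} else Set.univ) (by
      intro y
      split_ifs
      · exact convex_singleton _
      · exact convex_univ) (by
      intro y
      by_cases h : y = x
      · subst h
        obtain ⟨s, hs, hc⟩ := FiberBundle.exists_contMDiffOn_extend (k := ∞) 𝓘(ℝ, E) F v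
        refine ⟨s, hs, _, hc, ?_⟩
        intro z hz
        split_ifs with h'
        · subst h'; simp
        · trivial
      · refine ⟨{x}ᶜ, isOpen_compl_singleton.mem_nhds h, fun _ => 0, ?_, ?_⟩
        · exact (contMDiff_zeroSection ℝ V).contMDiffOn
        · intro z hz
          have : z ≠ x := hz
          simp [this])
  refine ⟨s, ?_⟩
  have := hs x
  change s x = v
  simpa using this

variable (E F V) in
/-- A choice, linear in the vector, of a smooth section with prescribed value at `x`. -/
def smoothExt [ContMDiffVectorBundle ∞ F V 𝓘(ℝ, E)] (x : M) :
    V x →ₗ[ℝ] ContMDiffSection 𝓘(ℝ, E) F ∞ V :=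
  ((evalAt E F V x).exists_rightInverse_of_surjective
    (LinearMap.range_eq_top.mpr (evalAt_surjective x))).choose

theorem smoothExt_apply_self [ContMDiffVectorBundle ∞ F V 𝓘(ℝ, E)] (x : M) (v : V x) :
    smoothExt E F V x v x = v :=
  LinearMap.congr_fun ((evalAt E F V x).exists_rightInverse_of_surjective
    (LinearMap.range_eq_top.mpr (evalAt_surjective x))).choose_spec v

end Extension

/-! ## Lie algebroids, connections, momentum sections -/

section Algebroid

variable {E : Type*} [NormedAddCommGroup E] [NormedSpace ℝ E] [FiniteDimensional ℝ E]
  {M : Type*} [TopologicalSpace M] [ChartedSpace E M] [IsManifold 𝓘(ℝ, E) ∞ M]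
  {F : Type*} [NormedAddCommGroup F] [NormedSpace ℝ F] [FiniteDimensional ℝ F]
  {A : M → Type*} [TopologicalSpace (TotalSpace F A)]
  [∀ x, AddCommGroup (A x)] [∀ x, Module ℝ (A x)] [∀ x, TopologicalSpace (A x)]
  [∀ x, IsTopologicalAddGroup (A x)] [∀ x, ContinuousSMul ℝ (A x)]
  [FiberBundle F A] [VectorBundle ℝ F A] [ContMDiffVectorBundle ∞ F A 𝓘(ℝ, E)]

variable (E F A) in
/-- Smooth sections of `A`. -/
abbrev Sec : Type _ := ContMDiffSection 𝓘(ℝ, E) F ∞ A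

variable (E F A) in
/-- Smooth sections of the dual bundle `A*`. -/
abbrev DualSec : Type _ :=
  ContMDiffSection 𝓘(ℝ, E) (F →L[ℝ] ℝ) ∞ (fun x => A x →L[ℝ] ℝ)

variable (E F A) in
/-- A Lie algebroid structure on the vector bundle `A → M`: a smooth anchor `ρ : A → TM` and an
`ℝ`-bilinear alternating bracket on smooth sections that satisfies the Jacobi identity and the
Leibniz rule `[a, f b] = f [a, b] + (ρ a · f) b`. -/
structure LieAlgebroid where
  anchor : ContMDiffSection 𝓘(ℝ, E) (F →L[ℝ] E) ∞ (fun x => A x →L[ℝ] TangentSpace 𝓘(ℝ, E) x)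
  bracket : Sec E F A →ₗ[ℝ] Sec E F A →ₗ[ℝ] Sec E F A
  bracket_self : ∀ a, bracket a a = 0
  jacobi : ∀ a b c,
    bracket a (bracket b c) + bracket b (bracket c a) + bracket c (bracket a b) = 0
  leibniz : ∀ (a b : Sec E F A) (f : M → ℝ) (hf : ContMDiff 𝓘(ℝ, E) 𝓘(ℝ, ℝ) ∞ f) (x : M),
    bracket a (⟨f • ⇑b, hf.smul_section b.contMDiff⟩ : Sec E F A) x =
      f x • bracket a b x + mvfderiv 𝓘(ℝ, E) f x (anchor x (a x)) • b x

/-- The vector field `ρ a`. -/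
def LieAlgebroid.rho (L : LieAlgebroid E F A) (a : Sec E F A) (x : M) : TangentSpace 𝓘(ℝ, E) x :=
  L.anchor x (a x)

/-- The Lie algebroid differential of a section `μ` of `A*`:
`(d_A μ)(a, b) = ρ a · ⟨μ, b⟩ - ρ b · ⟨μ, a⟩ - ⟨μ, [a, b]⟩`. -/
def LieAlgebroid.d (L : LieAlgebroid E F A) (μ : DualSec E F A) (a b : Sec E F A) (x : M) : ℝ :=
  mvfderiv 𝓘(ℝ, E) (fun y => μ y (b y)) x (L.rho a x)
    - mvfderiv 𝓘(ℝ, E) (fun y => μ y (a y)) x (L.rho b x) - μ x (L.bracket a b x)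

theorem mdifferentiableAt_pair {F₁ : Type*} [NormedAddCommGroup F₁] [NormedSpace ℝ F₁]
    {V : M → Type*} [TopologicalSpace (TotalSpace F₁ V)]
    [∀ x, AddCommGroup (V x)] [∀ x, Module ℝ (V x)] [∀ x, TopologicalSpace (V x)]
    [∀ x, IsTopologicalAddGroup (V x)] [∀ x, ContinuousSMul ℝ (V x)]
    [FiberBundle F₁ V] [VectorBundle ℝ F₁ V]
    (μ : ContMDiffSection 𝓘(ℝ, E) (F₁ →L[ℝ] ℝ) ∞ (fun x => V x →L[ℝ] ℝ))
    {a : ∀ x, V x} {x : M}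
    (ha : MDifferentiableAt 𝓘(ℝ, E) (𝓘(ℝ, E).prod 𝓘(ℝ, F₁)) (fun y => TotalSpace.mk' F₁ y (a y)) x) :
    MDifferentiableAt 𝓘(ℝ, E) 𝓘(ℝ, ℝ) (fun y => μ y (a y)) x := by
  have h := MDifferentiableAt.clm_bundle_apply (F₁ := F₁) (F₂ := ℝ) (E₁ := V)
    (E₂ := Bundle.Trivial M ℝ) (b := id) (μ.mdifferentiableAt (x := x)) ha
  rw [mdifferentiableAt_totalSpace] at h
  exact h.2

/-- The 1-form `⟨Dμ, a⟩` at `x`, for the dual connection on `A*`: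
`⟨D_v μ, a⟩ = v · ⟨μ, a⟩ - ⟨μ, D_v a⟩`. -/
def dualPairing (D : CovariantDerivative 𝓘(ℝ, E) F A) (μ : DualSec E F A) (a : ∀ x, A x) (x : M) :
    TangentSpace 𝓘(ℝ, E) x →L[ℝ] ℝ :=
  mvfderiv 𝓘(ℝ, E) (fun y => μ y (a y)) x - (μ x).comp (D a x)

theorem dualPairing_tensorial (D : CovariantDerivative 𝓘(ℝ, E) F A) (μ : DualSec E F A) (x : M)  :
    TensorialAt 𝓘(ℝ, E) F (fun a => dualPairing D μ a x) x where
  smul {f a} hf ha := by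
    have h1 := mdifferentiableAt_pair μ ha
    have h2 := mvfderiv_mul hf h1
    have h3 := D.isCovariantDerivativeOnUniv.leibniz ha hf
    ext v
    have h2' := congrArg (fun l => l v) h2
    have e : (fun y => μ y ((f • a) y)) = f * (fun y => μ y (a y)) := by
      ext y; simp
    simp only [dualPairing, e, h2, h3]
    simp
    ring
  add {a b} ha hb := by
    have h2 := mvfderiv_add (mdifferentiableAt_pair μ ha) (mdifferentiableAt_pair μ hb)
    have h3 := D.isCovariantDerivativeOnUniv.add ha hb
    have e : (fun y => μ y ((a + b) y)) = (fun y => μ y (a y)) + (fun y => μ y (b y)) := by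
      ext y; simp
    ext v
    simp only [dualPairing, e, h2, h3]
    simp
    ring

theorem dualPairing_apply_tensorial (D : CovariantDerivative 𝓘(ℝ, E) F A) (μ : DualSec E F A)
    (x : M) (v : TangentSpace 𝓘(ℝ, E) x) :
    TensorialAt 𝓘(ℝ, E) F (fun a => dualPairing D μ a x v) x where
  smul hf ha := by
    simpa using congrArg (fun l => l v) ((dualPairing_tensorial D μ x).smul hf ha)
  add ha hb := by
    simpa using congrArg (fun l => l v) ((dualPairing_tensorial D μ x).add ha hb)

/-- The covariant derivative `v ↦ D_v μ ∈ A*_x` of a section `μ` of `A*` with respect to the dual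
connection. The pairing `⟨D_v μ, a⟩` depends only on the value of `a` at `x`, and
`TensorialAt.mkHom` is the resulting linear form on `A_x`. -/
def dualDeriv (D : CovariantDerivative 𝓘(ℝ, E) F A) (μ : DualSec E F A) (x : M) :
    TangentSpace 𝓘(ℝ, E) x →L[ℝ] (A x →L[ℝ] ℝ) :=
  haveI : FiniteDimensional ℝ (TangentSpace 𝓘(ℝ, E) x) := inferInstanceAs (FiniteDimensional ℝ E)
  haveI : T2Space (TangentSpace 𝓘(ℝ, E) x) := inferInstanceAs (T2Space E)
  LinearMap.toContinuousLinearMap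
    { toFun := fun v => TensorialAt.mkHom (fun a => dualPairing D μ a x v) x
        (dualPairing_apply_tensorial D μ x v)
      map_add' := fun v w => by ext a; simp [TensorialAt.mkHom_apply_eq_extend]
      map_smul' := fun c v => by ext a; simp [TensorialAt.mkHom_apply_eq_extend] }

theorem dualDeriv_apply (D : CovariantDerivative 𝓘(ℝ, E) F A) (μ : DualSec E F A) (a : Sec E F A)
    (x : M) (v : TangentSpace 𝓘(ℝ, E) x) : dualDeriv D μ x v (a x) = dualPairing D μ a x v :=
  TensorialAt.mkHom_apply (dualPairing_apply_tensorial D μ x v) a.mdifferentiableAt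

/-- The opposite `A`-connection on vector fields: `Ď_a v = [ρ a, v] + ρ (D_v a)`. -/
def oppositeDeriv (L : LieAlgebroid E F A) (D : CovariantDerivative 𝓘(ℝ, E) F A) (a : Sec E F A)
    (v : ∀ x : M, TangentSpace 𝓘(ℝ, E) x) (x : M) : TangentSpace 𝓘(ℝ, E) x :=
  VectorField.mlieBracket 𝓘(ℝ, E) (L.rho a) v x + L.anchor x (D a x (v x))

/-- The pairing `⟨Ď_a β, v⟩ = ρ a · ⟨β, v⟩ - ⟨β, Ď_a v⟩` of the dual of the opposite connection. -/
def oppositePairing (L : LieAlgebroid E F A) (D : CovariantDerivative 𝓘(ℝ, E) F A) (a : Sec E F A)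
    (β : OneForm 𝓘(ℝ, E) M) (x : M) (v : ∀ x : M, TangentSpace 𝓘(ℝ, E) x) : ℝ :=
  mvfderiv 𝓘(ℝ, E) (fun y => β y (v y)) x (L.rho a x) - β x (oppositeDeriv L D a v x)

theorem oppositePairing_tensorial (L : LieAlgebroid E F A) (D : CovariantDerivative 𝓘(ℝ, E) F A)
    (a : Sec E F A) (β : OneForm 𝓘(ℝ, E) M) (x : M) :
    TensorialAt 𝓘(ℝ, E) E (oppositePairing L D a β x) x where
  smul {f v} hf hv := by
    have := FiniteDimensional.complete ℝ E
    have h2 := mvfderiv_mul hf (mdifferentiableAt_pair β hv)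
    have h3 := VectorField.mlieBracket_smul_right (V := L.rho a) hf hv
    have e : (fun y => β y ((f • v) y)) = f * (fun y => β y (v y)) := by
      ext y; simp
    simp only [oppositePairing, oppositeDeriv, e, h2, h3]
    simp
    ring
  add {v w} hv hw := by
    have := FiniteDimensional.complete ℝ E
    have h2 := mvfderiv_add (mdifferentiableAt_pair β hv) (mdifferentiableAt_pair β hw)
    have h3 := VectorField.mlieBracket_add_right (V := L.rho a) hv hw
    have e : (fun y => β y ((v + w) y)) = (fun y => β y (v y)) + (fun y => β y (w y)) := by
      ext y; simp
    simp only [oppositePairing, oppositeDeriv, e, h2, h3]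
    simp
    ring

/-- The covariant derivative `Ď_a β` of a 1-form for the dual of the opposite connection. -/
def oppositeForm (L : LieAlgebroid E F A) (D : CovariantDerivative 𝓘(ℝ, E) F A) (a : Sec E F A)
    (β : OneForm 𝓘(ℝ, E) M) (x : M) : TangentSpace 𝓘(ℝ, E) x →L[ℝ] ℝ :=
  TensorialAt.mkHom (oppositePairing L D a β x) x (oppositePairing_tensorial L D a β x)

/-- `A` is Poisson anchored with respect to `D`: `Ď Π = 0`, where
`(Ď_a Π)(α, β) = ρ a · Π(α, β) - Π(Ď_a α, β) - Π(α, Ď_a β)`. -/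
def IsPoissonAnchored (Pi : BivectorField 𝓘(ℝ, E) M) (L : LieAlgebroid E F A)
    (D : CovariantDerivative 𝓘(ℝ, E) F A) : Prop :=
  ∀ (a : Sec E F A) (α β : OneForm 𝓘(ℝ, E) M) (x : M),
    mvfderiv 𝓘(ℝ, E) (fun y => Pi.toFun y (α y) (β y)) x (L.rho a x)
      - Pi.toFun x (oppositeForm L D a α x) (β x)
      - Pi.toFun x (α x) (oppositeForm L D a β x) = 0

/-- `μ` is a `D`-momentum section: `ρ a = ι_{⟨Dμ, a⟩} Π` for all sections `a`. -/
def IsMomentumSection (Pi : BivectorField 𝓘(ℝ, E) M) (L : LieAlgebroid E F A)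
    (D : CovariantDerivative 𝓘(ℝ, E) F A) (μ : DualSec E F A) : Prop :=
  ∀ (a : Sec E F A) (x : M), Pi.IsContraction (dualPairing D μ a x) (L.rho a x)

/-- A bracket-compatible `D`-momentum section: a momentum section with
`(d_A μ)(a, b) = Π(⟨Dμ, a⟩, ⟨Dμ, b⟩)` for all sections `a`, `b`. -/
structure IsBracketCompatibleMomentumSection (Pi : BivectorField 𝓘(ℝ, E) M)
    (L : LieAlgebroid E F A) (D : CovariantDerivative 𝓘(ℝ, E) F A) (μ : DualSec E F A) : Prop where
  momentum : IsMomentumSection Pi L D μ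
  compatible : ∀ (a b : Sec E F A) (x : M),
    L.d μ a b x = Pi.toFun x (dualPairing D μ a x) (dualPairing D μ b x)

theorem LieAlgebroid.d_add_left (L : LieAlgebroid E F A) (μ : DualSec E F A) (a a' b : Sec E F A)
    (x : M) : L.d μ (a + a') b x = L.d μ a b x + L.d μ a' b x := by
  have h := mvfderiv_add (mdifferentiableAt_pair μ (a.mdifferentiableAt (x := x)))
    (mdifferentiableAt_pair μ (a'.mdifferentiableAt (x := x)))
  have e : (fun y => μ y ((a + a') y)) = (fun y => μ y (a y)) + (fun y => μ y (a' y)) := by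
    ext y; simp
  simp only [LieAlgebroid.d, LieAlgebroid.rho, e, h]
  simp
  ring

theorem LieAlgebroid.d_smul_left (L : LieAlgebroid E F A) (μ : DualSec E F A) (c : ℝ)
    (a b : Sec E F A) (x : M) : L.d μ (c • a) b x = c * L.d μ a b x := by
  have h := mvfderiv_mul (I := 𝓘(ℝ, E)) (mdifferentiableAt_const (c := c) (x := x))
    (mdifferentiableAt_pair μ (a.mdifferentiableAt (x := x)))
  rw [mvfderiv_const] at h
  have e : (fun y => μ y ((c • a) y)) = (fun _ => c) * (fun y => μ y (a y)) := by
    ext y; simp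
  simp only [LieAlgebroid.d, LieAlgebroid.rho, e, h]
  simp
  ring

theorem LieAlgebroid.bracket_swap (L : LieAlgebroid E F A) (a b : Sec E F A) :
    L.bracket a b = - L.bracket b a := by
  have h := L.bracket_self (a + b)
  simp only [map_add, LinearMap.add_apply, L.bracket_self] at h
  rw [eq_neg_iff_add_eq_zero]
  simpa [add_comm] using h

theorem LieAlgebroid.d_swap (L : LieAlgebroid E F A) (μ : DualSec E F A) (a b : Sec E F A)
    (x : M) : L.d μ a b x = - L.d μ b a x := by
  simp only [LieAlgebroid.d, L.bracket_swap a b]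
  simp
  ring

/-! ## The bivector fields on the total space of `A*` -/

variable (F A) in
/-- The total space of `A*`. -/
abbrev DualTotal : Type _ := TotalSpace (F →L[ℝ] ℝ) (fun x : M => A x →L[ℝ] ℝ)

variable (E F) in
/-- The model of the manifold `A*`. -/
abbrev DualModel : ModelWithCorners ℝ (E × (F →L[ℝ] ℝ)) (ModelProd E (F →L[ℝ] ℝ)) :=
  𝓘(ℝ, E).prod 𝓘(ℝ, F →L[ℝ] ℝ)

/-- A section of `A*` as a map `M → A*`. -/
def DualSec.toMap (μ : DualSec E F A) (x : M) : DualTotal F A := ⟨x, μ x⟩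

/-- The vertical lift `A*_x → T_ξ A*`: the derivative at `ξ ∈ A*_x` of the inclusion of the fibre
`A*_x`, the latter being identified linearly with the model fibre. -/
def vlift (ξ : DualTotal F A) :
    (A ξ.proj →L[ℝ] ℝ) →L[ℝ] TangentSpace (DualModel E F) ξ :=
  let e := trivializationAt (F →L[ℝ] ℝ) (fun x : M => A x →L[ℝ] ℝ) ξ.proj
  (mfderiv 𝓘(ℝ, F →L[ℝ] ℝ) (DualModel E F)
      (fun w : F →L[ℝ] ℝ => (⟨ξ.proj, e.symmL ℝ ξ.proj w⟩ : DualTotal F A))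
      (e.continuousLinearMapAt ℝ ξ.proj ξ.2)).comp
    (e.continuousLinearMapAt ℝ ξ.proj)

/-- The vertical part `α^V ∈ A_x` of a covector `α ∈ T*_ξ A*`, `ξ ∈ A*_x`: the element of `A_x` with
`⟨η, α^V⟩ = α(vertical lift of η)` for all `η ∈ A*_x`. -/
def vpart (ξ : DualTotal F A) :
    (TangentSpace (DualModel E F) ξ →L[ℝ] ℝ) →ₗ[ℝ] A ξ.proj :=
  have : FiniteDimensional ℝ (A ξ.proj) := VectorBundle.finiteDimensional ℝ F A ξ.proj
  have : T2Space (A ξ.proj) := FiberBundle.t2Space F A ξ.proj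
  (Module.evalEquiv ℝ (A ξ.proj)).symm.toLinearMap ∘ₗ
    { toFun := fun α =>
        (α.comp (vlift ξ)).toLinearMap ∘ₗ
          (LinearMap.toContinuousLinearMap : (A ξ.proj →ₗ[ℝ] ℝ) ≃ₗ[ℝ] (A ξ.proj →L[ℝ] ℝ)).toLinearMap
      map_add' := fun α β => by ext; simp
      map_smul' := fun c α => by ext; simp }

theorem apply_vpart (ξ : DualTotal F A) (α : TangentSpace (DualModel E F) ξ →L[ℝ] ℝ)
    (η : A ξ.proj →L[ℝ] ℝ) : η (vpart ξ α) = α (vlift ξ η) := by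
  have : FiniteDimensional ℝ (A ξ.proj) := VectorBundle.finiteDimensional ℝ F A ξ.proj
  have : T2Space (A ξ.proj) := FiberBundle.t2Space F A ξ.proj
  have := Module.apply_evalEquiv_symm_apply ℝ (A ξ.proj) η.toLinearMap
    ((α.comp (vlift ξ)).toLinearMap ∘ₗ
          (LinearMap.toContinuousLinearMap : (A ξ.proj →ₗ[ℝ] ℝ) ≃ₗ[ℝ] (A ξ.proj →L[ℝ] ℝ)).toLinearMap)
  exact this

section Lifts

variable [T2Space M] [SigmaCompactSpace M]

/-- A smooth section of `A*` through `ξ`. The constructions below do not depend on the choice. -/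
def sectionThrough (ξ : DualTotal F A) : DualSec E F A :=
  smoothExt E (F →L[ℝ] ℝ) (fun x : M => A x →L[ℝ] ℝ) ξ.proj ξ.2

/-- The differential `T_x M → T_ξ A*` of the chosen section through `ξ ∈ A*_x`. -/
def sectionDeriv (ξ : DualTotal F A) :
    TangentSpace 𝓘(ℝ, E) ξ.proj →L[ℝ] TangentSpace (DualModel E F) ξ :=
  mfderiv 𝓘(ℝ, E) (DualModel E F) (DualSec.toMap (sectionThrough (E := E) ξ)) ξ.proj

/-- The horizontal lift `T_x M → T_ξ A*` at `ξ ∈ A*_x` for the dual connection: for a section `σ`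
with `σ(x) = ξ`, it is `v ↦ dσ(v) - (vertical lift of D_v σ)`. -/
def hlift (D : CovariantDerivative 𝓘(ℝ, E) F A) (ξ : DualTotal F A) :
    TangentSpace 𝓘(ℝ, E) ξ.proj →L[ℝ] TangentSpace (DualModel E F) ξ :=
  sectionDeriv ξ - (vlift ξ).comp (dualDeriv D (sectionThrough ξ) ξ.proj)

/-- The horizontal lift `Π̂` to `A*` of a bivector field `Π` on `M`. -/
def horizontalLift (Pi : BivectorField 𝓘(ℝ, E) M) (D : CovariantDerivative 𝓘(ℝ, E) F A) :
    BivectorField (DualModel E F) (DualTotal F A) where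
  toFun ξ := LinearMap.mk₂ ℝ
    (fun α β => Pi.toFun ξ.proj (α.comp (hlift D ξ)) (β.comp (hlift D ξ)))
    (fun α α' β => by simp [ContinuousLinearMap.add_comp])
    (fun c α β => by simp [ContinuousLinearMap.smul_comp])
    (fun α β β' => by simp [ContinuousLinearMap.add_comp])
    (fun c α β => by simp [ContinuousLinearMap.smul_comp])
  self_eq_zero ξ α := Pi.self_eq_zero _ _

/-- The map `α ↦ dσ(ρ α^V)`, where `σ` is the chosen section through `ξ`. -/
def anchorLift (L : LieAlgebroid E F A) (ξ : DualTotal F A) :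
    (TangentSpace (DualModel E F) ξ →L[ℝ] ℝ) →ₗ[ℝ] TangentSpace (DualModel E F) ξ :=
  (sectionDeriv ξ).toLinearMap ∘ₗ (L.anchor ξ.proj).toLinearMap ∘ₗ vpart ξ

/-- The linear map `α ↦ α^V` followed by the chosen extension of elements of `A_x` to smooth
sections of `A`. -/
def vpartSection (ξ : DualTotal F A) :
    (TangentSpace (DualModel E F) ξ →L[ℝ] ℝ) →ₗ[ℝ] Sec E F A :=
  smoothExt E F A ξ.proj ∘ₗ vpart ξ

/-- The Lie algebroid bivector field `Π_A` on `A*`, in the form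
`Π_A(α, β) = β(dσ(ρ α^V)) - α(dσ(ρ β^V)) - (d_A σ)(α^V, β^V)` at `ξ ∈ A*_x`, where `σ` is a
section of `A*` with `σ(x) = ξ`. -/
def liePoisson (L : LieAlgebroid E F A) : BivectorField (DualModel E F) (DualTotal F A) where
  toFun ξ := LinearMap.mk₂ ℝ
      (fun α β => β (anchorLift L ξ α) - α (anchorLift L ξ β)
        - L.d (sectionThrough ξ) (vpartSection ξ α) (vpartSection ξ β) ξ.proj)
      (fun α α' β => by
        rw [(anchorLift L ξ).map_add, (vpartSection ξ).map_add, L.d_add_left, β.map_add]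
        simp only [_root_.add_apply]; ring)
      (fun c α β => by
        rw [(anchorLift L ξ).map_smul, (vpartSection ξ).map_smul, L.d_smul_left, β.map_smul]
        simp only [_root_.smul_apply, smul_eq_mul]; ring)
      (fun α β β' => by
        rw [(anchorLift L ξ).map_add, (vpartSection ξ).map_add, L.d_swap _ (vpartSection ξ α),
          L.d_swap _ (vpartSection ξ α), L.d_swap _ (vpartSection ξ α), L.d_add_left, α.map_add]
        simp only [_root_.add_apply]; ring)
      (fun c α β => by
        rw [(anchorLift L ξ).map_smul, (vpartSection ξ).map_smul, L.d_swap _ (vpartSection ξ α),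
          L.d_swap _ (vpartSection ξ α), L.d_smul_left, α.map_smul]
        simp only [_root_.smul_apply, smul_eq_mul]; ring)
  self_eq_zero ξ α := by
    have h := L.d_swap (sectionThrough ξ) (vpartSection ξ α) (vpartSection ξ α) ξ.proj
    rw [LinearMap.mk₂_apply]
    linarith

end Lifts

/-! ## The brackets of `Π̂` and `Π_A`

The following facts express these brackets on fibrewise linear and on basic functions; since the
differentials of such functions span all cotangent spaces of `A*`, they determine both bivector
fields and show that the chosen sections are immaterial. -/

section Brackets

/-- The fibrewise linear function on `A*` given by a section of `A`. -/
def linearFun (a : Sec E F A) (ξ : DualTotal F A) : ℝ := ξ.2 (a ξ.proj)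

/-- The pullback to `A*` of a function on `M`. -/
def pullbackFun (f : M → ℝ) (ξ : DualTotal F A) : ℝ := f ξ.proj

theorem mdifferentiableAt_linearFun (a : Sec E F A) (ξ : DualTotal F A) :
    MDifferentiableAt (DualModel E F) 𝓘(ℝ, ℝ) (linearFun a) ξ := by
  have hp : MDifferentiableAt (DualModel E F) 𝓘(ℝ, E) (TotalSpace.proj : DualTotal F A → M) ξ :=
    (contMDiff_proj (fun x : M => A x →L[ℝ] ℝ) (n := ∞)).mdifferentiable (by simp) ξ
  have ha : MDifferentiableAt (DualModel E F) (𝓘(ℝ, E).prod 𝓘(ℝ, F))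
      (fun ξ : DualTotal F A => TotalSpace.mk' F ξ.proj (a ξ.proj)) ξ :=
    (a.mdifferentiableAt (x := ξ.proj)).comp ξ hp
  have h := MDifferentiableAt.clm_bundle_apply (F₁ := F) (F₂ := ℝ) (E₁ := A)
    (E₂ := Bundle.Trivial M ℝ) (b := fun ξ : DualTotal F A => ξ.proj) (ϕ := fun ξ => ξ.2)
    (mdifferentiableAt_id (x := ξ)) ha
  rw [mdifferentiableAt_totalSpace] at h
  exact h.2

theorem mdifferentiableAt_pullbackFun {f : M → ℝ} {ξ : DualTotal F A}
    (hf : MDifferentiableAt 𝓘(ℝ, E) 𝓘(ℝ, ℝ) f ξ.proj) :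
    MDifferentiableAt (DualModel E F) 𝓘(ℝ, ℝ) (pullbackFun f) ξ := by
  have hp : MDifferentiableAt (DualModel E F) 𝓘(ℝ, E) (TotalSpace.proj : DualTotal F A → M) ξ :=
    (contMDiff_proj (fun x : M => A x →L[ℝ] ℝ) (n := ∞)).mdifferentiable (by simp) ξ
  exact hf.comp ξ hp

theorem mvfderiv_vlift {G : DualTotal F A → ℝ} {ξ : DualTotal F A}
    (hG : MDifferentiableAt (DualModel E F) 𝓘(ℝ, ℝ) G ξ) (η : A ξ.proj →L[ℝ] ℝ) :
    mvfderiv (DualModel E F) G ξ (vlift ξ η) =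
      fderiv ℝ (fun w : F →L[ℝ] ℝ => G ⟨ξ.proj, (trivializationAt (F →L[ℝ] ℝ)
        (fun x : M => A x →L[ℝ] ℝ) ξ.proj).symmL ℝ ξ.proj w⟩)
        ((trivializationAt (F →L[ℝ] ℝ) (fun x : M => A x →L[ℝ] ℝ) ξ.proj).continuousLinearMapAt ℝ
          ξ.proj ξ.2)
        ((trivializationAt (F →L[ℝ] ℝ) (fun x : M => A x →L[ℝ] ℝ) ξ.proj).continuousLinearMapAt ℝ
          ξ.proj η) := by
  set e := trivializationAt (F →L[ℝ] ℝ) (fun x : M => A x →L[ℝ] ℝ) ξ.proj with he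
  have hx : ξ.proj ∈ e.baseSet := FiberBundle.mem_baseSet_trivializationAt' _
  have hpt : (⟨ξ.proj, e.symmL ℝ ξ.proj (e.continuousLinearMapAt ℝ ξ.proj ξ.2)⟩ : DualTotal F A) = ξ := by
    rw [e.symmL_continuousLinearMapAt hx]
  have hj : MDifferentiableAt 𝓘(ℝ, F →L[ℝ] ℝ) (DualModel E F)
      (fun w : F →L[ℝ] ℝ => (⟨ξ.proj, e.symmL ℝ ξ.proj w⟩ : DualTotal F A))
      (e.continuousLinearMapAt ℝ ξ.proj ξ.2) := by
    rw [mdifferentiableAt_totalSpace]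
    refine ⟨mdifferentiableAt_const, ?_⟩
    have : (fun w : F →L[ℝ] ℝ => (e ⟨ξ.proj, e.symmL ℝ ξ.proj w⟩).2) = fun w => w := by
      ext1 w
      simp [hx]
    simp only [← he, this]
    exact mdifferentiableAt_id
  have h := mvfderiv_comp_apply_of_eq _ hG hj hpt (e.continuousLinearMapAt ℝ ξ.proj η)
  refine h.symm.trans ?_
  change mfderiv 𝓘(ℝ, F →L[ℝ] ℝ) 𝓘(ℝ, ℝ) _ _ _ = _
  rw [mfderiv_eq_fderiv]
  rfl

theorem linearFun_vlift (a : Sec E F A) (ξ : DualTotal F A) (η : A ξ.proj →L[ℝ] ℝ) :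
    mvfderiv (DualModel E F) (linearFun a) ξ (vlift ξ η) = η (a ξ.proj) := by
  rw [mvfderiv_vlift (mdifferentiableAt_linearFun a ξ)]
  set e := trivializationAt (F →L[ℝ] ℝ) (fun x : M => A x →L[ℝ] ℝ) ξ.proj with he
  have hx : ξ.proj ∈ e.baseSet := FiberBundle.mem_baseSet_trivializationAt' _
  let l : (F →L[ℝ] ℝ) →ₗ[ℝ] ℝ :=
    { toFun := fun w => e.symmL ℝ ξ.proj w (a ξ.proj)
      map_add' := fun w w' => by simp
      map_smul' := fun c w => by simp }
  have : (fun w : F →L[ℝ] ℝ => linearFun a (⟨ξ.proj, e.symmL ℝ ξ.proj w⟩ : DualTotal F A))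
      = LinearMap.toContinuousLinearMap l := by
    ext w; rfl
  rw [this, ContinuousLinearMap.fderiv]
  change e.symmL ℝ ξ.proj (e.continuousLinearMapAt ℝ ξ.proj η) (a ξ.proj) = _
  rw [e.symmL_continuousLinearMapAt hx]

theorem pullbackFun_vlift {f : M → ℝ} (ξ : DualTotal F A)
    (hf : MDifferentiableAt 𝓘(ℝ, E) 𝓘(ℝ, ℝ) f ξ.proj) (η : A ξ.proj →L[ℝ] ℝ) :
    mvfderiv (DualModel E F) (pullbackFun f) ξ (vlift ξ η) = 0 := by
  rw [mvfderiv_vlift (mdifferentiableAt_pullbackFun hf)]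
  simp [pullbackFun]

theorem eq_of_dual_apply (ξ : DualTotal F A) {u v : A ξ.proj}
    (h : ∀ η : A ξ.proj →L[ℝ] ℝ, η u = η v) : u = v := by
  have : FiniteDimensional ℝ (A ξ.proj) := VectorBundle.finiteDimensional ℝ F A ξ.proj
  have : T2Space (A ξ.proj) := FiberBundle.t2Space F A ξ.proj
  rw [← sub_eq_zero, ← Module.forall_dual_apply_eq_zero_iff ℝ]
  intro φ
  have := h (LinearMap.toContinuousLinearMap φ)
  simpa [sub_eq_zero] using this

theorem vpart_linearFun (a : Sec E F A) (ξ : DualTotal F A) :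
    vpart ξ (mvfderiv (DualModel E F) (linearFun a) ξ) = a ξ.proj :=
  eq_of_dual_apply ξ fun η =>
    (apply_vpart ξ _ η).trans (linearFun_vlift a ξ η)

theorem vpart_pullbackFun {f : M → ℝ} (ξ : DualTotal F A)
    (hf : MDifferentiableAt 𝓘(ℝ, E) 𝓘(ℝ, ℝ) f ξ.proj) :
    vpart ξ (mvfderiv (DualModel E F) (pullbackFun f) ξ) = 0 :=
  eq_of_dual_apply ξ fun η =>
    (apply_vpart ξ _ η).trans ((pullbackFun_vlift ξ hf η).trans η.map_zero.symm)

variable [T2Space M] [SigmaCompactSpace M]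

theorem sectionThrough_self (ξ : DualTotal F A) : DualSec.toMap (sectionThrough (E := E) ξ) ξ.proj = ξ := by
  have := smoothExt_apply_self (E := E) (F := F →L[ℝ] ℝ) (V := fun x : M => A x →L[ℝ] ℝ) ξ.proj ξ.2
  unfold DualSec.toMap sectionThrough
  rw [this]

theorem mvfderiv_sectionDeriv {G : DualTotal F A → ℝ} {ξ : DualTotal F A}
    (hG : MDifferentiableAt (DualModel E F) 𝓘(ℝ, ℝ) G ξ) (v : TangentSpace 𝓘(ℝ, E) ξ.proj) :
    mvfderiv (DualModel E F) G ξ (sectionDeriv ξ v) =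
      mvfderiv 𝓘(ℝ, E) (G ∘ DualSec.toMap (sectionThrough (E := E) ξ)) ξ.proj v :=
  (mvfderiv_comp_apply_of_eq ξ.proj hG (sectionThrough ξ).mdifferentiableAt
    (sectionThrough_self ξ) v).symm

theorem pullbackFun_sectionDeriv {f : M → ℝ} (ξ : DualTotal F A)
    (hf : MDifferentiableAt 𝓘(ℝ, E) 𝓘(ℝ, ℝ) f ξ.proj) (v : TangentSpace 𝓘(ℝ, E) ξ.proj) :
    mvfderiv (DualModel E F) (pullbackFun f) ξ (sectionDeriv ξ v) = mvfderiv 𝓘(ℝ, E) f ξ.proj v :=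
  mvfderiv_sectionDeriv (mdifferentiableAt_pullbackFun hf) v

theorem linearFun_sectionDeriv (a : Sec E F A) (ξ : DualTotal F A)
    (v : TangentSpace 𝓘(ℝ, E) ξ.proj) :
    mvfderiv (DualModel E F) (linearFun a) ξ (sectionDeriv ξ v) =
      mvfderiv 𝓘(ℝ, E) (fun y => sectionThrough (E := E) ξ y (a y)) ξ.proj v :=
  mvfderiv_sectionDeriv (mdifferentiableAt_linearFun a ξ) v

theorem pullbackFun_hlift (D : CovariantDerivative 𝓘(ℝ, E) F A) {f : M → ℝ} (ξ : DualTotal F A)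
    (hf : MDifferentiableAt 𝓘(ℝ, E) 𝓘(ℝ, ℝ) f ξ.proj) :
    (mvfderiv (DualModel E F) (pullbackFun f) ξ).comp (hlift D ξ) = mvfderiv 𝓘(ℝ, E) f ξ.proj := by
  ext v
  change mvfderiv (DualModel E F) (pullbackFun f) ξ (sectionDeriv ξ v - vlift ξ _) = _
  rw [ContinuousLinearMap.map_sub, pullbackFun_sectionDeriv ξ hf, pullbackFun_vlift ξ hf, sub_zero]

theorem linearFun_hlift (D : CovariantDerivative 𝓘(ℝ, E) F A) (a : Sec E F A) (ξ : DualTotal F A) :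
    (mvfderiv (DualModel E F) (linearFun a) ξ).comp (hlift D ξ) = ξ.2.comp (D a ξ.proj) := by
  ext v
  change mvfderiv (DualModel E F) (linearFun a) ξ (sectionDeriv ξ v - vlift ξ _) = _
  rw [ContinuousLinearMap.map_sub, linearFun_sectionDeriv, linearFun_vlift]
  have h2 := dualDeriv_apply D (sectionThrough ξ) a ξ.proj v
  refine (congrArg (fun t => _ - t) h2).trans ?_
  have := smoothExt_apply_self (E := E) (F := F →L[ℝ] ℝ) (V := fun x : M => A x →L[ℝ] ℝ) ξ.proj ξ.2
  simp only [dualPairing]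
  simp
  unfold sectionThrough
  rw [this]

/-- `{f, g}_Π̂ = {f, g}_Π`, `{a, f}_Π̂ = Π(Da, df)`, `{a, b}_Π̂ = Π(Da, Db)`. -/
theorem horizontalLift_brackets (Pi : BivectorField 𝓘(ℝ, E) M) (D : CovariantDerivative 𝓘(ℝ, E) F A)
    (a b : Sec E F A) (f g : M → ℝ) (ξ : DualTotal F A)
    (hf : MDifferentiableAt 𝓘(ℝ, E) 𝓘(ℝ, ℝ) f ξ.proj)
    (hg : MDifferentiableAt 𝓘(ℝ, E) 𝓘(ℝ, ℝ) g ξ.proj) :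
    (horizontalLift Pi D).bracket (pullbackFun f) (pullbackFun g) ξ = Pi.bracket f g ξ.proj ∧
    (horizontalLift Pi D).bracket (linearFun a) (pullbackFun f) ξ =
      Pi.toFun ξ.proj (ξ.2.comp (D a ξ.proj)) (mvfderiv 𝓘(ℝ, E) f ξ.proj) ∧
    (horizontalLift Pi D).bracket (linearFun a) (linearFun b) ξ =
      Pi.toFun ξ.proj (ξ.2.comp (D a ξ.proj)) (ξ.2.comp (D b ξ.proj)) := by
  simp only [BivectorField.bracket, horizontalLift, LinearMap.mk₂_apply, pullbackFun_hlift D ξ hf,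
    pullbackFun_hlift D ξ hg, linearFun_hlift, and_self]


theorem LieAlgebroid.d_fun_smul_left (L : LieAlgebroid E F A) (μ : DualSec E F A) (a b : Sec E F A)
    (f : M → ℝ) (hf : ContMDiff 𝓘(ℝ, E) 𝓘(ℝ, ℝ) ∞ f) (x : M) :
    L.d μ ⟨f • ⇑a, hf.smul_section a.contMDiff⟩ b x = f x * L.d μ a b x := by
  have h := mvfderiv_mul (I := 𝓘(ℝ, E)) (hf.mdifferentiable (by simp) x)
    (mdifferentiableAt_pair μ (a.mdifferentiableAt (x := x)))
  have e : (fun y => μ y ((⟨f • ⇑a, hf.smul_section a.contMDiff⟩ : Sec E F A) y)) =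
      f * (fun y => μ y (a y)) := by
    ext y
    change μ y (f y • a y) = _
    simp
  have h2 : L.bracket ⟨f • ⇑a, hf.smul_section a.contMDiff⟩ b x =
     f x • L.bracket a b x - mvfderiv 𝓘(ℝ, E) f x (L.anchor x (b x)) • a x := by
    rw [L.bracket_swap, L.bracket_swap a b]
    have := L.leibniz b a f hf x
    simp only [ContMDiffSection.coe_neg, Pi.neg_apply, this]
    module
  have h3 : L.rho ⟨f • ⇑a, hf.smul_section a.contMDiff⟩ x = f x • L.rho a x := by
    change L.anchor x (f x • a x) = _
    simp [LieAlgebroid.rho]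
  simp only [LieAlgebroid.d, e, h, h2, h3]
  simp [LieAlgebroid.rho]
  ring

theorem LieAlgebroid.d_eq_zero (L : LieAlgebroid E F A) (μ : DualSec E F A) (a b : Sec E F A)
    {x : M} (ha : a x = 0) : L.d μ a b x = 0 := by
  classical
  let t := trivializationAt F A x
  have hx : x ∈ t.baseSet := FiberBundle.mem_baseSet_trivializationAt' x
  obtain ⟨ψ, -, hψ⟩ := (SmoothBumpFunction.nhds_basis_tsupport (I := 𝓘(ℝ, E)) x).mem_iff.1
    (t.open_baseSet.mem_nhds hx)
  have hψs : ContMDiff 𝓘(ℝ, E) 𝓘(ℝ, ℝ) ∞ ψ := ψ.contMDiff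
  let bs := Module.finBasis ℝ F
  let c := fun i y => t.localFrameCoeff 𝓘(ℝ, E) bs i y (a y)
  let fr := fun i => t.localFrame bs i
  have hfr : ∀ i, ContMDiff 𝓘(ℝ, E) (𝓘(ℝ, E).prod 𝓘(ℝ, F)) ∞
      (fun y => TotalSpace.mk' F y ((⇑ψ • fr i) y)) := fun i =>
    ContMDiffOn.smul_section_of_tsupport hψs.contMDiffOn t.open_baseSet hψ
      (fun y hy => (_root_.contMDiffAt_localFrame_of_mem ∞ t bs i hy).contMDiffWithinAt)
  have hc : ∀ i, ContMDiff 𝓘(ℝ, E) 𝓘(ℝ, ℝ) ∞ (⇑ψ * c i) := fun i => by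
    apply contMDiff_of_tsupport
    intro y hy
    have hy' : y ∈ t.baseSet := hψ (tsupport_mul_subset_left hy)
    exact hψs.contMDiffAt.mul
      (_root_.contMDiffAt_localFrameCoeff bs hy' a.contMDiff.contMDiffAt i)
  let s : Fin (Module.finrank ℝ F) → Sec E F A := fun i => ⟨⇑ψ • fr i, hfr i⟩
  have hψψ : ContMDiff 𝓘(ℝ, E) 𝓘(ℝ, ℝ) ∞ (⇑ψ * ⇑ψ) := hψs.mul hψs
  let dl : Sec E F A →ₗ[ℝ] ℝ :=
    { toFun := fun a => L.d μ a b x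
      map_add' := fun a a' => L.d_add_left μ a a' b x
      map_smul' := fun c a => L.d_smul_left μ c a b x }
  have key : (⟨(⇑ψ * ⇑ψ) • ⇑a, hψψ.smul_section a.contMDiff⟩ : Sec E F A) =
      ∑ i, ⟨(⇑ψ * c i) • ⇑(s i), (hc i).smul_section (s i).contMDiff⟩ := by
    apply ContMDiffSection.ext
    intro y
    have hsum : (∑ i, (⟨(⇑ψ * c i) • ⇑(s i), (hc i).smul_section (s i).contMDiff⟩ : Sec E F A)) y
        = ∑ i, (ψ y * c i y) • (ψ y • fr i y) := by
      have := map_sum (evalAt E F A y) (fun i =>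
        (⟨(⇑ψ * c i) • ⇑(s i), (hc i).smul_section (s i).contMDiff⟩ : Sec E F A)) Finset.univ
      exact this
    rw [hsum]
    change (ψ y * ψ y) • a y = _
    by_cases hy : y ∈ t.baseSet
    · have h := t.eq_sum_localFrameCoeff_smul (I := 𝓘(ℝ, E)) (b := bs) (s := ⇑a) hy
      conv_lhs => rw [h]
      rw [Finset.smul_sum]
      refine Finset.sum_congr rfl fun i _ => ?_
      simp only [c, fr, smul_smul]
      congr 1
      ring
    · have : ψ y = 0 := image_eq_zero_of_notMem_tsupport fun h => hy (hψ h)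
      simp [this]
  have h1 := congrArg dl key
  rw [map_sum] at h1
  have h2 : dl ⟨(⇑ψ * ⇑ψ) • ⇑a, hψψ.smul_section a.contMDiff⟩ = L.d μ a b x := by
    refine (L.d_fun_smul_left μ a b _ hψψ x).trans ?_
    simp
  rw [← h2, h1]
  refine Finset.sum_eq_zero fun i _ => ?_
  refine (L.d_fun_smul_left μ (s i) b _ (hc i) x).trans ?_
  simp [c, ha]

theorem LieAlgebroid.d_congr (L : LieAlgebroid E F A) (μ : DualSec E F A) {a a' b b' : Sec E F A}
    {x : M} (ha : a x = a' x) (hb : b x = b' x) : L.d μ a b x = L.d μ a' b' x := by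
  have key : ∀ {a a' : Sec E F A} (b : Sec E F A), a x = a' x → L.d μ a b x = L.d μ a' b x := by
    intro a a' b h
    have h0 := L.d_eq_zero μ (a - a') b (x := x) (by simp [h])
    have h1 := L.d_add_left μ (a - a') a' b x
    rw [sub_add_cancel, h0, zero_add] at h1
    exact h1
  rw [key b ha, L.d_swap, key a' hb, ← L.d_swap]

theorem anchorLift_eq (L : LieAlgebroid E F A) (ξ : DualTotal F A)
    (α : TangentSpace (DualModel E F) ξ →L[ℝ] ℝ) :
    anchorLift L ξ α = sectionDeriv ξ (L.anchor ξ.proj (vpart ξ α)) := rfl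

/-- `{f, g}_{Π_A} = 0`, `{a, f}_{Π_A} = ρ a · f`, `{a, b}_{Π_A} = [a, b]`. -/
theorem liePoisson_brackets (L : LieAlgebroid E F A) (a b : Sec E F A) (f g : M → ℝ)
    (ξ : DualTotal F A)
    (hf : MDifferentiableAt 𝓘(ℝ, E) 𝓘(ℝ, ℝ) f ξ.proj)
    (hg : MDifferentiableAt 𝓘(ℝ, E) 𝓘(ℝ, ℝ) g ξ.proj) :
    (liePoisson L).bracket (pullbackFun f) (pullbackFun g) ξ = 0 ∧
    (liePoisson L).bracket (linearFun a) (pullbackFun f) ξ =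
      mvfderiv 𝓘(ℝ, E) f ξ.proj (L.rho a ξ.proj) ∧
    (liePoisson L).bracket (linearFun a) (linearFun b) ξ = linearFun (L.bracket a b) ξ := by
  have hsec : ∀ α, vpartSection (E := E) ξ α = smoothExt E F A ξ.proj (vpart ξ α) := fun _ => rfl
  have hself := smoothExt_apply_self (E := E) (F := F →L[ℝ] ℝ) (V := fun x : M => A x →L[ℝ] ℝ) ξ.proj ξ.2
  have hd0 : ∀ a : Sec E F A, L.d (sectionThrough ξ) 0 a ξ.proj = 0 := fun a =>
    L.d_eq_zero _ 0 a rfl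
  have hd0' : ∀ a : Sec E F A, L.d (sectionThrough ξ) a 0 ξ.proj = 0 := fun a => by
    rw [L.d_swap, hd0, neg_zero]
  simp only [BivectorField.bracket, liePoisson, LinearMap.mk₂_apply, anchorLift_eq, hsec,
    vpart_pullbackFun ξ hf, vpart_pullbackFun ξ hg, vpart_linearFun, LinearMap.map_zero,
    hd0, hd0', ContinuousLinearMap.map_zero, sub_zero]
  refine ⟨trivial, ?_, ?_⟩
  · exact pullbackFun_sectionDeriv ξ hf _
  · rw [linearFun_sectionDeriv, linearFun_sectionDeriv,
      L.d_congr (sectionThrough ξ) (a' := a) (b' := b) (smoothExt_apply_self _ _)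
        (smoothExt_apply_self _ _)]
    simp only [LieAlgebroid.d, LieAlgebroid.rho, linearFun]
    unfold sectionThrough
    rw [hself]
    ring

end Brackets

end Algebroid

end HamLA

namespace HamLA

variable {E : Type*} [NormedAddCommGroup E] [NormedSpace ℝ E] [FiniteDimensional ℝ E]
  {M : Type*} [TopologicalSpace M] [ChartedSpace E M] [IsManifold 𝓘(ℝ, E) ∞ M]
  {F : Type*} [NormedAddCommGroup F] [NormedSpace ℝ F] [FiniteDimensional ℝ F]
  {A : M → Type*} [TopologicalSpace (TotalSpace F A)]
  [∀ x, AddCommGroup (A x)] [∀ x, Module ℝ (A x)] [∀ x, TopologicalSpace (A x)]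
  [∀ x, IsTopologicalAddGroup (A x)] [∀ x, ContinuousSMul ℝ (A x)]
  [FiberBundle F A] [VectorBundle ℝ F A] [ContMDiffVectorBundle ∞ F A 𝓘(ℝ, E)]

/-! By the chain rule, both sides of the bivector map condition at `x` depend only on the covectors
`df`, `dg` at `μ x`, and bilinearly. Differentials of fibrewise linear functions (sections `a` of
`A`) and of basic functions (pullbacks from `M`) span each cotangent space of `A*`; this is
`exists_eq_mvfderiv_linearFun_add_pullbackFun`. So it suffices to test three kinds of pairs, which
is `isBivectorMap_toMap_iff`.

Write `P = ⟨Dμ, a⟩`, `Q = ⟨Dμ, b⟩`, `p = ⟨μ, Da⟩`, `q = ⟨μ, Db⟩`, so that `d⟨μ, a⟩ = P + p` and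
`d⟨μ, b⟩ = Q + q`. Two basic functions impose nothing. The pair `(a, f)` gives `Π(p, df) + ρ a · f =
Π(P + p, df)`, which is the momentum condition. The pair `(a, b)` gives `Π(p, q) + ⟨μ, [a, b]⟩ = Π(P
+ p, Q + q)`. Under the momentum condition `(d_A μ)(a, b) = 2 Π(P, Q) + Π(P, q) + Π(p, Q) - ⟨μ, [a,
b]⟩`, so the last equation is bracket compatibility. -/

/-! ### Smooth functions on `A*` and on `M` -/

theorem contMDiff_linearFun (a : Sec E F A) :
    ContMDiff (DualModel E F) 𝓘(ℝ, ℝ) ∞ (linearFun a) := by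
  have ha : ContMDiff (DualModel E F) (𝓘(ℝ, E).prod 𝓘(ℝ, F)) ∞
      (fun ξ : DualTotal F A => TotalSpace.mk' F ξ.proj (a ξ.proj)) :=
    a.contMDiff.comp (contMDiff_proj (fun x : M => A x →L[ℝ] ℝ))
  -- The identity of `A*` is the tautological section of the pullback of `A*` along the projection;
  -- the linear function is its pairing with the pullback of `a`.
  have h := ContMDiff.clm_bundle_apply (F₁ := F) (F₂ := ℝ) (E₁ := A)
    (E₂ := Bundle.Trivial M ℝ) (b := fun ξ : DualTotal F A => ξ.proj) (ϕ := fun ξ => ξ.2)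
    contMDiff_id ha
  intro ξ
  have h' := h ξ
  rw [contMDiffAt_totalSpace] at h'
  exact h'.2

theorem contMDiff_pullbackFun {f : M → ℝ} (hf : ContMDiff 𝓘(ℝ, E) 𝓘(ℝ, ℝ) ∞ f) :
    ContMDiff (DualModel E F) 𝓘(ℝ, ℝ) ∞ (pullbackFun f : DualTotal F A → ℝ) :=
  hf.comp (contMDiff_proj (fun x : M => A x →L[ℝ] ℝ))

/-- Every covector is the differential of a smooth function. -/
theorem exists_contMDiff_mvfderiv_eq [T2Space M] (x : M) (β : TangentSpace 𝓘(ℝ, E) x →L[ℝ] ℝ) :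
    ∃ f : M → ℝ, ContMDiff 𝓘(ℝ, E) 𝓘(ℝ, ℝ) ∞ f ∧ mvfderiv 𝓘(ℝ, E) f x = β := by
  have : IsManifold 𝓘(ℝ, E) 1 M := IsManifold.of_le (n := ∞) (by simp)
  let l : E →L[ℝ] ℝ := β
  let ψ : SmoothBumpFunction 𝓘(ℝ, E) x := Classical.choice inferInstance
  have hchart : ContMDiffOn 𝓘(ℝ, E) 𝓘(ℝ, E) ∞ (chartAt E x) (chartAt E x).source :=
    contMDiffOn_chart
  -- The form `β` read as a linear function in the chart at `x`, cut off to be globally smooth; the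
  -- cutoff is 1 near `x` and leaves the differential there unchanged.
  refine ⟨fun y => ψ y • l (chartAt E x y),
    ψ.contMDiff_smul (l.contMDiff.comp_contMDiffOn hchart), ?_⟩
  have hev : (fun y => ψ y • l (chartAt E x y)) =ᶠ[𝓝 x] l ∘ chartAt E x := by
    filter_upwards [ψ.eventuallyEq_one] with y hy
    simp [hy]
  have hd : MDifferentiableAt 𝓘(ℝ, E) 𝓘(ℝ, E) (chartAt E x) x :=
    (hchart.contMDiffAt ((chartAt E x).open_source.mem_nhds
      (mem_chart_source E x))).mdifferentiableAt (by simp)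
  ext v
  change mfderiv 𝓘(ℝ, E) 𝓘(ℝ, ℝ) _ x v = l v
  rw [hev.mfderiv_eq,
    mfderiv_comp x (l.hasMFDerivAt (x := chartAt E x x)).mdifferentiableAt hd,
    l.hasMFDerivAt.mfderiv, mfderiv_chartAt_eq_tangentCoordChange (mem_chart_source E x)]
  -- The tangent space at `x` is modelled on `E` through the preferred chart at `x`, so the
  -- derivative of that chart at `x` is the identity.
  exact congrArg l (tangentCoordChange_self (mem_extChartAt_source x))

/-! ### Tangent and cotangent spaces of the total space of `A*` -/

variable [T2Space M] [SigmaCompactSpace M]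

/-- The tangent space of `A*` at `ξ` is spanned by the vertical vectors and the image of the
differential of a section through `ξ`. -/
theorem exists_sectionDeriv_add_vlift (ξ : DualTotal F A) (w : TangentSpace (DualModel E F) ξ) :
    ∃ (v : TangentSpace 𝓘(ℝ, E) ξ.proj) (η : A ξ.proj →L[ℝ] ℝ),
      w = sectionDeriv ξ v + vlift ξ η := by
  have : FiniteDimensional ℝ (A ξ.proj) := VectorBundle.finiteDimensional ℝ F A ξ.proj
  have : T2Space (A ξ.proj) := FiberBundle.t2Space F A ξ.proj
  -- Source and target both have dimension `dim M + rank A`, so surjectivity of `T` reduces to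
  -- injectivity, which is tested against differentials of functions.
  let T : (TangentSpace 𝓘(ℝ, E) ξ.proj × (A ξ.proj →L[ℝ] ℝ)) →ₗ[ℝ]
      TangentSpace (DualModel E F) ξ :=
    (sectionDeriv ξ).toLinearMap.coprod (vlift ξ).toLinearMap
  have e : (A ξ.proj →L[ℝ] ℝ) ≃L[ℝ] (F →L[ℝ] ℝ) :=
    (trivializationAt (F →L[ℝ] ℝ) (fun x : M => A x →L[ℝ] ℝ) ξ.proj).continuousLinearEquivAt ℝ
      ξ.proj (FiberBundle.mem_baseSet_trivializationAt' _)
  have : FiniteDimensional ℝ (TangentSpace 𝓘(ℝ, E) ξ.proj) :=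
    inferInstanceAs (FiniteDimensional ℝ E)
  have : FiniteDimensional ℝ (TangentSpace (DualModel E F) ξ) :=
    inferInstanceAs (FiniteDimensional ℝ (E × (F →L[ℝ] ℝ)))
  have : FiniteDimensional ℝ (A ξ.proj →L[ℝ] ℝ) := e.symm.toLinearEquiv.finiteDimensional
  have hdim : Module.finrank ℝ (TangentSpace 𝓘(ℝ, E) ξ.proj × (A ξ.proj →L[ℝ] ℝ)) =
      Module.finrank ℝ (TangentSpace (DualModel E F) ξ) :=
    ((LinearEquiv.refl ℝ E).prodCongr e.toLinearEquiv).finrank_eq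
  have hinj : Function.Injective T := by
    rw [injective_iff_map_eq_zero]
    rintro ⟨v, η⟩ h
    have h : sectionDeriv ξ v + vlift ξ η = 0 := h
    -- Basic functions do not see vertical vectors, and their differentials give every covector on
    -- `M`.
    have hv : v = 0 := by
      have : ∀ β : TangentSpace 𝓘(ℝ, E) ξ.proj →L[ℝ] ℝ, β v = 0 := fun β => by
        obtain ⟨f, hf, rfl⟩ := exists_contMDiff_mvfderiv_eq ξ.proj β
        have hf' := hf.mdifferentiable (by simp) ξ.proj
        have h' := congrArg (mvfderiv (DualModel E F) (pullbackFun f) ξ) h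
        rwa [ContinuousLinearMap.map_add, pullbackFun_sectionDeriv ξ hf',
          pullbackFun_vlift ξ hf', add_zero, ContinuousLinearMap.map_zero] at h'
      exact SeparatingDual.eq_zero_of_forall_dual_eq_zero (R := ℝ) (V := E) this
    subst hv
    -- With `v = 0`, the linear function of `a` reads off `η` on `a`, and sections of `A` take every
    -- value at a point.
    have hη : η = 0 := by
      ext u
      obtain ⟨a, rfl⟩ := evalAt_surjective (E := E) (F := F) (V := A) ξ.proj u
      have h' := congrArg (mvfderiv (DualModel E F) (linearFun a) ξ) h
      rwa [ContinuousLinearMap.map_zero, zero_add, linearFun_vlift,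
        ContinuousLinearMap.map_zero] at h'
    rw [hη]
    rfl
  obtain ⟨⟨v, η⟩, h⟩ := (LinearMap.injective_iff_surjective_of_finrank_eq_finrank hdim).1 hinj w
  exact ⟨v, η, h.symm⟩

/-- The differentials of fibrewise linear and of basic functions span the cotangent spaces of
`A*`. -/
theorem exists_eq_mvfderiv_linearFun_add_pullbackFun (ξ : DualTotal F A)
    (α : TangentSpace (DualModel E F) ξ →L[ℝ] ℝ) :
    ∃ (a : Sec E F A) (f : M → ℝ), ContMDiff 𝓘(ℝ, E) 𝓘(ℝ, ℝ) ∞ f ∧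
      α = mvfderiv (DualModel E F) (linearFun a) ξ +
        mvfderiv (DualModel E F) (pullbackFun f) ξ := by
  -- Basic functions have no vertical part, so `a` must account for that of `α`. The function `f`
  -- then supplies what is missing along the section through `ξ`, without disturbing the vertical
  -- directions.
  obtain ⟨a, ha⟩ := evalAt_surjective (E := E) (F := F) (V := A) ξ.proj (vpart ξ α)
  obtain ⟨f, hf, hfd⟩ := exists_contMDiff_mvfderiv_eq ξ.proj
    ((α - mvfderiv (DualModel E F) (linearFun a) ξ).comp (sectionDeriv ξ))
  have hf' := hf.mdifferentiable (by simp) ξ.proj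
  refine ⟨a, f, hf, ?_⟩
  ext w
  obtain ⟨v, η, rfl⟩ := exists_sectionDeriv_add_vlift ξ w
  have h1 : α (vlift ξ η) = η (a ξ.proj) := by
    rw [← apply_vpart, ← ha]
    rfl
  have h2 : mvfderiv (DualModel E F) (pullbackFun f) ξ (sectionDeriv ξ v) =
      α (sectionDeriv ξ v) - mvfderiv (DualModel E F) (linearFun a) ξ (sectionDeriv ξ v) := by
    rw [pullbackFun_sectionDeriv ξ hf', hfd]
    rfl
  rw [_root_.add_apply, ContinuousLinearMap.map_add, ContinuousLinearMap.map_add,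
    ContinuousLinearMap.map_add, h1, h2, linearFun_vlift, pullbackFun_vlift ξ hf']
  ring

/-! ### Bivector maps tested on linear and basic functions -/

namespace BivectorField

theorem add_bracket {E₁ : Type*} [NormedAddCommGroup E₁] [NormedSpace ℝ E₁]
    {H₁ : Type*} [TopologicalSpace H₁] {I₁ : ModelWithCorners ℝ E₁ H₁}
    {N : Type*} [TopologicalSpace N] [ChartedSpace H₁ N] (Φ Ψ : BivectorField I₁ N)
    (f g : N → ℝ) (x : N) : (Φ + Ψ).bracket f g x = Φ.bracket f g x + Ψ.bracket f g x := rfl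

theorem toFun_swap {E₁ : Type*} [NormedAddCommGroup E₁] [NormedSpace ℝ E₁]
    {H₁ : Type*} [TopologicalSpace H₁] {I₁ : ModelWithCorners ℝ E₁ H₁}
    {N : Type*} [TopologicalSpace N] [ChartedSpace H₁ N] (Φ : BivectorField I₁ N)
    (x : N) (α β : TangentSpace I₁ x →L[ℝ] ℝ) : Φ.toFun x α β = - Φ.toFun x β α := by
  have h := Φ.self_eq_zero x (α + β)
  simp only [map_add, LinearMap.add_apply, Φ.self_eq_zero] at h
  linarith

end BivectorField

/-- This makes the bracket of `G ∘ μ` and `G' ∘ μ` at `x` a bilinear expression in the covectors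
`dG`, `dG'` at `μ x`. -/
theorem mvfderiv_comp_toMap (μ : DualSec E F A) {G : DualTotal F A → ℝ} {x : M}
    (hG : MDifferentiableAt (DualModel E F) 𝓘(ℝ, ℝ) G (DualSec.toMap μ x)) :
    mvfderiv 𝓘(ℝ, E) (G ∘ DualSec.toMap μ) x =
      (mvfderiv (DualModel E F) G (DualSec.toMap μ x)).comp
        (mfderiv 𝓘(ℝ, E) (DualModel E F) (DualSec.toMap μ) x) := by
  ext v
  exact mvfderiv_comp_apply_of_eq x hG μ.mdifferentiableAt rfl v

/-- To be a bivector map, it is enough for `μ` to be compatible with the brackets of fibrewise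
linear and of basic functions. -/
theorem isBivectorMap_toMap_iff (Pi : BivectorField 𝓘(ℝ, E) M)
    (Ψ : BivectorField (DualModel E F) (DualTotal F A)) (μ : DualSec E F A) :
    IsBivectorMap Pi Ψ (DualSec.toMap μ) ↔ ∀ x : M,
      (∀ f g : M → ℝ, ContMDiff 𝓘(ℝ, E) 𝓘(ℝ, ℝ) ∞ f → ContMDiff 𝓘(ℝ, E) 𝓘(ℝ, ℝ) ∞ g →
        Ψ.bracket (pullbackFun f) (pullbackFun g) (DualSec.toMap μ x) = Pi.bracket f g x) ∧
      (∀ (a : Sec E F A) (f : M → ℝ), ContMDiff 𝓘(ℝ, E) 𝓘(ℝ, ℝ) ∞ f →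
        Ψ.bracket (linearFun a) (pullbackFun f) (DualSec.toMap μ x) =
          Pi.bracket (fun y => μ y (a y)) f x) ∧
      (∀ a b : Sec E F A, Ψ.bracket (linearFun a) (linearFun b) (DualSec.toMap μ x) =
        Pi.bracket (fun y => μ y (a y)) (fun y => μ y (b y)) x) := by
  constructor
  · intro h x
    exact ⟨fun f g hf hg => congrFun
        (h.pullback_bracket _ _ (contMDiff_pullbackFun hf) (contMDiff_pullbackFun hg)) x,
      fun a f hf => congrFun
        (h.pullback_bracket _ _ (contMDiff_linearFun a) (contMDiff_pullbackFun hf)) x,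
      fun a b => congrFun
        (h.pullback_bracket _ _ (contMDiff_linearFun a) (contMDiff_linearFun b)) x⟩
  · intro h
    refine ⟨μ.contMDiff, fun G G' hG hG' => funext fun x => ?_⟩
    obtain ⟨h₁, h₂, h₃⟩ := h x
    have hGd := mvfderiv_comp_toMap μ (hG.mdifferentiable (by simp) (DualSec.toMap μ x))
    have hGd' := mvfderiv_comp_toMap μ (hG'.mdifferentiable (by simp) (DualSec.toMap μ x))
    -- A decomposition at the single point `μ x` suffices, since brackets involve only the
    -- differentials there.
    obtain ⟨a, f, hf, hα⟩ := exists_eq_mvfderiv_linearFun_add_pullbackFun (DualSec.toMap μ x)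
      (mvfderiv (DualModel E F) G (DualSec.toMap μ x))
    obtain ⟨b, g, hg, hβ⟩ := exists_eq_mvfderiv_linearFun_add_pullbackFun (DualSec.toMap μ x)
      (mvfderiv (DualModel E F) G' (DualSec.toMap μ x))
    -- Composed with `μ`, the linear function of `a` is `⟨μ, a⟩` and the pullback of `f` is `f`;
    -- used from right to left, the chain rule turns the pulled-back summands into `d⟨μ, a⟩` and
    -- `df`.
    have hlin : ∀ a : Sec E F A, mvfderiv 𝓘(ℝ, E) (fun y => μ y (a y)) x = _ :=
      fun a => mvfderiv_comp_toMap μ (mdifferentiableAt_linearFun a (DualSec.toMap μ x))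
    have hpull : ∀ {f : M → ℝ}, ContMDiff 𝓘(ℝ, E) 𝓘(ℝ, ℝ) ∞ f → mvfderiv 𝓘(ℝ, E) f x = _ :=
      fun hf => mvfderiv_comp_toMap μ
        ((contMDiff_pullbackFun hf).mdifferentiable (by simp) (DualSec.toMap μ x))
    rw [hα, ContinuousLinearMap.add_comp, ← hlin a, ← hpull hf] at hGd
    rw [hβ, ContinuousLinearMap.add_comp, ← hlin b, ← hpull hg] at hGd'
    have e₁ := h₁ f g hf hg
    have e₂ := h₂ a g hg
    have e₃ := h₂ b f hf
    have e₄ := h₃ a b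
    change Ψ.toFun _ (mvfderiv (DualModel E F) G (DualSec.toMap μ x))
      (mvfderiv (DualModel E F) G' (DualSec.toMap μ x)) = Pi.toFun _ _ _
    rw [hGd, hGd', hα, hβ]
    simp only [map_add, LinearMap.add_apply]
    -- The mixed term in `f` and `b` has the basic function first; skew-symmetry on both sides
    -- brings it to the form of `h₂`.
    rw [Ψ.toFun_swap _ (mvfderiv (DualModel E F) (pullbackFun f) _) (mvfderiv _ (linearFun b) _),
      Pi.toFun_swap _ (mvfderiv 𝓘(ℝ, E) f x) (mvfderiv 𝓘(ℝ, E) (fun y => μ y (b y)) x)]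
    simp only [BivectorField.bracket] at e₁ e₂ e₃ e₄
    rw [e₁, e₂, e₃, e₄]

end HamLA

/-! ### The equivalence -/

theorem mainTheorem3
    {E : Type*} [NormedAddCommGroup E] [NormedSpace ℝ E] [FiniteDimensional ℝ E]
    {M : Type*} [TopologicalSpace M] [ChartedSpace E M] [IsManifold 𝓘(ℝ, E) ∞ M]
    [T2Space M] [SigmaCompactSpace M]
    {F : Type*} [NormedAddCommGroup F] [NormedSpace ℝ F] [FiniteDimensional ℝ F]
    {A : M → Type*} [TopologicalSpace (TotalSpace F A)]
    [∀ x, AddCommGroup (A x)] [∀ x, Module ℝ (A x)] [∀ x, TopologicalSpace (A x)]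
    [∀ x, IsTopologicalAddGroup (A x)] [∀ x, ContinuousSMul ℝ (A x)]
    [FiberBundle F A] [VectorBundle ℝ F A] [ContMDiffVectorBundle ∞ F A 𝓘(ℝ, E)]
    (Pi : HamLA.BivectorField 𝓘(ℝ, E) M) (hPi : Pi.IsPoisson)
    (L : HamLA.LieAlgebroid E F A)
    (D : CovariantDerivative 𝓘(ℝ, E) F A) (hDsmooth : D.ContMDiffCovariantDerivative ∞)
    (hD : HamLA.IsPoissonAnchored Pi L D)
    (μ : HamLA.DualSec E F A) :
    HamLA.IsBracketCompatibleMomentumSection Pi L D μ ↔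
      HamLA.IsBivectorMap Pi (HamLA.horizontalLift Pi D + HamLA.liePoisson L)
        (HamLA.DualSec.toMap μ) := by
  -- The contraction is tested against all covectors, and each of them is some `df`.
  have hmom : HamLA.IsMomentumSection Pi L D μ ↔ ∀ (a : HamLA.Sec E F A) (x : M) (f : M → ℝ),
      ContMDiff 𝓘(ℝ, E) 𝓘(ℝ, ℝ) ∞ f → mvfderiv 𝓘(ℝ, E) f x (L.rho a x) =
        Pi.toFun x (HamLA.dualPairing D μ a x) (mvfderiv 𝓘(ℝ, E) f x) := by
    constructor
    · exact fun h a x f _ => h a x _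
    · intro h a x β
      obtain ⟨f, hf, rfl⟩ := HamLA.exists_contMDiff_mvfderiv_eq x β
      exact h a x f hf
  have hd : ∀ (a : HamLA.Sec E F A) (x : M), mvfderiv 𝓘(ℝ, E) (fun y => μ y (a y)) x =
      HamLA.dualPairing D μ a x + (μ x).comp (D a x) := fun a x => by
    simp [HamLA.dualPairing]
  -- The momentum condition is evaluated on `Q`, `q` along `ρ a` and on `P`, `p` along `ρ b`. This
  -- replaces the anchor terms of `d_A μ` by values of `Π`, and the two equations then differ by a
  -- rearrangement.
  have hsum : ∀ (a b : HamLA.Sec E F A) (x : M), HamLA.IsMomentumSection Pi L D μ →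
      (L.d μ a b x = Pi.toFun x (HamLA.dualPairing D μ a x) (HamLA.dualPairing D μ b x) ↔
        Pi.toFun x ((μ x).comp (D a x)) ((μ x).comp (D b x)) + μ x (L.bracket a b x) =
          Pi.bracket (fun y => μ y (a y)) (fun y => μ y (b y)) x) := by
    intro a b x h
    have ha := h a x
    have hb := h b x
    have e₁ := ha (HamLA.dualPairing D μ b x)
    have e₂ := hb (HamLA.dualPairing D μ a x)
    have e₃ := ha ((μ x).comp (D b x))
    have e₄ := hb ((μ x).comp (D a x))
    rw [Pi.toFun_swap] at e₂ e₄
    simp only [HamLA.BivectorField.bracket, HamLA.LieAlgebroid.d, hd, map_add,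
      LinearMap.add_apply, _root_.add_apply, e₁, e₂, e₃, e₄]
    constructor <;> intro h <;> linarith
  have hbr : ∀ (a b : HamLA.Sec E F A) (f g : M → ℝ) (x : M),
      ContMDiff 𝓘(ℝ, E) 𝓘(ℝ, ℝ) ∞ f → ContMDiff 𝓘(ℝ, E) 𝓘(ℝ, ℝ) ∞ g → _ :=
    fun a b f g x hf hg => And.intro
      (HamLA.horizontalLift_brackets Pi D a b f g (HamLA.DualSec.toMap μ x)
        (hf.mdifferentiable (by simp) x) (hg.mdifferentiable (by simp) x))
      (HamLA.liePoisson_brackets L a b f g (HamLA.DualSec.toMap μ x)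
        (hf.mdifferentiable (by simp) x) (hg.mdifferentiable (by simp) x))
  -- The zero function fills the function slots of `hbr` where only brackets of linear functions are
  -- wanted.
  have h0 : ContMDiff 𝓘(ℝ, E) 𝓘(ℝ, ℝ) ∞ (fun _ : M => (0 : ℝ)) := contMDiff_const
  have hlf : ∀ (a : HamLA.Sec E F A) (f : M → ℝ) (x : M), ContMDiff 𝓘(ℝ, E) 𝓘(ℝ, ℝ) ∞ f →
      ((HamLA.horizontalLift Pi D + HamLA.liePoisson L).bracket (HamLA.linearFun a)
        (HamLA.pullbackFun f) (HamLA.DualSec.toMap μ x) =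
          Pi.bracket (fun y => μ y (a y)) f x ↔
        mvfderiv 𝓘(ℝ, E) f x (L.rho a x) =
          Pi.toFun x (HamLA.dualPairing D μ a x) (mvfderiv 𝓘(ℝ, E) f x)) := by
    intro a f x hf
    obtain ⟨⟨-, h₁, -⟩, -, h₂, -⟩ := hbr a a f f x hf hf
    rw [HamLA.BivectorField.add_bracket, h₁, h₂]
    -- The term `Π(p, df)` appears on both sides; cancelling it leaves the momentum condition.
    have e : Pi.bracket (fun y => μ y (a y)) f x =
        Pi.toFun x (HamLA.dualPairing D μ a x) (mvfderiv 𝓘(ℝ, E) f x) +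
          Pi.toFun x ((μ x).comp (D a x)) (mvfderiv 𝓘(ℝ, E) f x) := by
      simp only [HamLA.BivectorField.bracket, hd, map_add, LinearMap.add_apply]
    rw [e, add_comm]
    exact add_left_inj _
  have hll : ∀ (a b : HamLA.Sec E F A) (x : M),
      (HamLA.horizontalLift Pi D + HamLA.liePoisson L).bracket (HamLA.linearFun a)
        (HamLA.linearFun b) (HamLA.DualSec.toMap μ x) =
          Pi.toFun x ((μ x).comp (D a x)) ((μ x).comp (D b x)) + μ x (L.bracket a b x) := by
    intro a b x
    obtain ⟨⟨-, -, h₁⟩, -, -, h₂⟩ := hbr a b _ _ x h0 h0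
    rw [HamLA.BivectorField.add_bracket, h₁, h₂]
    rfl
  rw [HamLA.isBivectorMap_toMap_iff]
  constructor
  · rintro ⟨hm, hc⟩ x
    refine ⟨fun f g hf hg => ?_, fun a f hf => (hlf a f x hf).2 (hmom.1 hm a x f hf),
      fun a b => (hll a b x).trans ((hsum a b x hm).1 (hc a b x))⟩
    -- On basic functions `Π_A` vanishes and the horizontal lift restricts to `Π`, so this case
    -- holds for every `μ`.
    obtain ⟨⟨h₁, -, -⟩, h₂, -, -⟩ := hbr 0 0 f g x hf hg
    rw [HamLA.BivectorField.add_bracket, h₁, h₂, add_zero]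
    rfl
  · intro h
    -- The mixed brackets come first: the brackets of linear functions express compatibility only
    -- once the momentum condition is known.
    have hm : HamLA.IsMomentumSection Pi L D μ :=
      hmom.2 fun a x f hf => (hlf a f x hf).1 ((h x).2.1 a f hf)
    exact ⟨hm, fun a b x => (hsum a b x hm).2 ((hll a b x).symm.trans ((h x).2.2 a b))⟩
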